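/- Let $\mathfrak g$ be a complex simple Lie algebra of type $B_n=\mathfrak{so}(2n+1)$ ($n\ge 1$), $C_n=\mathfrak{sp}(2n)$ ($n\ge 1$) or $D_n=\mathfrak{so}(2n)$ ($n\ge 3$), and let $N=2n+1$ for type $B$ and $N=2n$ for types $C$, $D$. Let $\varepsilon_1,\dots,\varepsilon_n$ be an orthonormal basis of $\mathfrak h^*$, with simple roots $\alpha_i=\varepsilon_i-\varepsilon_{i+1}$ for $i<n$ and $\alpha_n=\varepsilon_n$, $2\varepsilon_n$, $\varepsilon_{n-1}+\varepsilon_n$ for types $B$, $C$, $D$ respectively. For $1\le k\le N$ put $k'=N+1-k$ and define $\varepsilon_k$ for $k>n$ by $\varepsilon_{k'}=-\varepsilon_k$ (so $\varepsilon_{n+1}=0$ for type $B$). For $\beta\in\Gamma^+=\sum_i\mathbb Z_{\ge 0}\,\alpha_i$ let $P(\beta)$ be the set of pairs $(i,j)$, $1\le i,j\le N$, with $\varepsilon_i-\varepsilon_j=\beta$. Let $q\in\mathbb C\setminus\{0\}$ be not a root of unity, and let $U_q(\mathfrak g)$ be the quantum group over $\mathbb C$ with generators $e_i,f_i,q^{\pm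 h_i}$ ($1\le i\le n$), where the $q^{h_i}$ are invertible and commute with each other, subject to the relations $q^{h_i}e_jq^{-h_i}=q^{(\alpha_i,\alpha_j)}e_j$, $q^{h_i}f_jq^{-h_i}=q^{-(\alpha_i,\alpha_j)}f_j$, $[e_i,f_j]=\delta_{ij}\frac{q^{h_i}-q^{-h_i}}{q^{d_i}-q^{-d_i}}$, and the $q$-Serre relations for the $e_i$ and for the $f_i$; here $d_i=(\alpha_i,\alpha_i)/2$, except that $d_n=1$ for type $B$. The comultiplication is given by $\Delta(e_i)=e_i\otimes 1+q^{h_i}\otimes e_i$, $\Delta(f_i)=f_i\otimes q^{-h_i}+1\otimes f_i$, $\Delta(q^{\pm h_i})=q^{\pm h_i}\otimes q^{\pm h_i}$. Let $U_q(\mathfrak g_-)$ be the algebra generated by the $f_i$ subject to the $q$-Serre relations. In the natural representation of $U_q(\mathfrak g)$ on $\mathbb C^N$ with standard basis $w_1,\dots,w_N$ and matrix units $e_{lr}$, the element $e_i$ acts as $\sum_{(l,r)\in P(\alpha_i)}e_{lr}$, the element $f_i$ acts as $\sum_{(l,r)\in P(\alpha_i)}e_{rl}$, and $q^{\pm h_i}w_k=q^{\pm(\alpha_i,\varepsilon_k)}w_k$.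 A Chevalley monomial of weight $\beta$ is a product $\psi=f_{i_1}\cdots f_{i_m}\in U_q(\mathfrak g_-)$ with $\alpha_{i_1}+\dots+\alpha_{i_m}=\beta$. For $(i,j)\in P(\beta)$ there is a Chevalley monomial sending $w_i$ to a non-zero multiple of $w_j$, which is unique as an element of $U_q(\mathfrak g_-)$; the principal monomial $\psi^{ij}\in U_q(\mathfrak g_-)$ is obtained from it by reversing the order of the factors. Let $\lambda$ be a weight, i.e. a choice of non-zero complex numbers $q^{(\lambda,\alpha_i)}$, $1\le i\le n$, let $M_\lambda$ be the Verma module over $U_q(\mathfrak g)$ of highest weight $\lambda$ with canonical generator $v_\lambda$ (so that $e_iv_\lambda=0$ and $q^{h_i}v_\lambda=q^{(\lambda,\alpha_i)}v_\lambda$), and let $U_q(\mathfrak g)$ act on $\mathbb C^N\otimes M_\lambda$ through $\Delta$. For $0\le m\le N$ let $V_m\subset\mathbb C^N\otimes M_\lambda$ be the $U_q(\mathfrak g)$-submodule generated by the vectors $w_k\otimes v_\lambda$ with $k\le m$. Then for every $\beta\in\Gamma^+$, every pair $(i,j)\in P(\beta)$ and every Chevalley monomial $\psi$ of weight $\beta$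 with $\psi\ne\psi^{ij}$ in $U_q(\mathfrak g_-)$, one has $w_i\otimes\psi v_\lambda\in V_{j-1}$. -/

import Mathlib

open scoped TensorProduct Matrix

/-! ## Root data of the orthogonal and symplectic Lie algebras -/

/-- The three series: `B` is `so(2n+1)`, `C` is `sp(2n)`, `D` is `so(2n)`. -/
inductive OrthosymplecticSeries
  | B | C | D

/-- The least rank `n` for which the Lie algebra of the series is simple. -/
def OrthosymplecticSeries.minRank : OrthosymplecticSeries → ℕ
  | .B => 1
  | .C => 1
  | .D => 3

/-- A complex simple Lie algebra `𝔤` of type `B`, `C` or `D`. -/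
structure OrthosymplecticType where
  series : OrthosymplecticSeries
  rank : ℕ
  minRank_le : series.minRank ≤ rank

namespace OrthosymplecticType

/-- The integral weights, in coordinates with respect to the orthonormal basis
`ε_1, …, ε_n` of `𝔥^*`; the inner product is the dot product `⬝ᵥ`. -/
abbrev Weight (g : OrthosymplecticType) : Type := Fin g.rank → ℤ

/-- The dimension `N` of the natural representation. -/
def natDim (g : OrthosymplecticType) : ℕ :=
  match g.series with
  | .B => 2 * g.rank + 1
  | .C => 2 * g.rank
  | .D => 2 * g.rank

/-- The `m`-th basis weight (indices start at `0`); it is `0` if `m ≥ n`. -/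
def unitWeight (g : OrthosymplecticType) (m : ℕ) : g.Weight :=
  fun a => if (a : ℕ) = m then 1 else 0

/-- The weight `ε_k` of the basis vector `w_k` of `ℂ^N`. Here `ε_{k'} = -ε_k` for
`k' = N - 1 - k` (indices start at `0`), and `ε_k = 0` if `k = k'`. -/
def ε (g : OrthosymplecticType) (k : Fin g.natDim) : g.Weight :=
  g.unitWeight k - g.unitWeight (g.natDim - 1 - k)

/-- The simple roots: `ε_i - ε_{i+1}`, except for the last one, which is `ε_n`, `2 ε_n`,
`ε_{n-1} + ε_n` in the respective series. -/
def α (g : OrthosymplecticType) (i : Fin g.rank) : g.Weight :=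
  if (i : ℕ) + 1 = g.rank then
    match g.series with
    | .B => g.unitWeight i
    | .C => g.unitWeight i + g.unitWeight i
    | .D => g.unitWeight (i - 1) + g.unitWeight i
  else g.unitWeight i - g.unitWeight (i + 1)

/-- The set `P(β)` of the pairs `(i, j)` with `ε_i - ε_j = β`. -/
def P (g : OrthosymplecticType) (β : g.Weight) : Set (Fin g.natDim × Fin g.natDim) :=
  {p | g.ε p.1 - g.ε p.2 = β}

/-- The inner products `(α_i, α_j)`. -/
def ip (g : OrthosymplecticType) (i j : Fin g.rank) : ℤ := g.α i ⬝ᵥ g.α j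

/-- The integer `d_i` in `[e_i, f_i] = [h_i]_q / [d_i]_q`. It is `(α_i, α_i) / 2`, except that
it is `1` for the short root of the series `B`, owing to the normalization
`f_n = [1/2]_q e_{-α_n}`. -/
def d (g : OrthosymplecticType) (i : Fin g.rank) : ℤ :=
  if g.ip i i = 1 then 1 else g.ip i i / 2

end OrthosymplecticType

/-! ## The quantum group -/

/-- `q ^ b` as a complex number. -/
noncomputable def qpow (q : ℂˣ) (b : ℤ) : ℂ := ((q ^ b : ℂˣ) : ℂ)

/-- The left-hand side of the `q`-Serre relation for `X = e_{±α}`, `x = e_{±β}`, where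
`b = (α, β)`, `c = (α, α)`. The Cartan integer `a = 2 b / c` is `0`, `-1` or `-2` for distinct
simple roots of the types `B`, `C`, `D` (so that the last branch is never used).
With `q_α = q ^ (c / 2)` the coefficients are `[2]_{q_α} = q^b + q^{-b}` if `a = -1` and
`[3]_{q_α} = q^b + 1 + q^{-b}` if `a = -2`. -/
noncomputable def qSerre {A : Type*} [Ring A] [Algebra ℂ A] (q : ℂˣ) (b c : ℤ) (X x : A) : A :=
  if b = 0 then X * x - x * X
  else if 2 * b = -c then
    X * X * x - (qpow q b + qpow q (-b)) • (X * x * X) + x * X * X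
  else if b = -c then
    X * X * X * x - (qpow q b + 1 + qpow q (-b)) • (X * X * x * X)
      + (qpow q b + 1 + qpow q (-b)) • (X * x * X * X) - x * X * X * X
  else 0

/-- Symbols for the generators `e_i`, `f_i`, `q^{h_i}`, `q^{-h_i}` of the quantum group. -/
inductive UqGen (g : OrthosymplecticType) : Type
  | E (i : Fin g.rank)
  | F (i : Fin g.rank)
  | K (i : Fin g.rank)
  | Kinv (i : Fin g.rank)

/-- The defining relations of `U_q(𝔤)`, for an arbitrary assignment of the generators.
The relation `[e_i, f_i] = [h_i]_q / [d_i]_q` is written without denominators. -/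
inductive UqRel (g : OrthosymplecticType) (q : ℂˣ) {A : Type*} [Ring A] [Algebra ℂ A]
    (t : UqGen g → A) : A → A → Prop
  | K_mul_Kinv (i) : UqRel g q t (t (.K i) * t (.Kinv i)) 1
  | Kinv_mul_K (i) : UqRel g q t (t (.Kinv i) * t (.K i)) 1
  | K_comm (i j) : UqRel g q t (t (.K i) * t (.K j)) (t (.K j) * t (.K i))
  | K_E (i j) : UqRel g q t (t (.K i) * t (.E j) * t (.Kinv i)) (qpow q (g.ip i j) • t (.E j))
  | K_F (i j) : UqRel g q t (t (.K i) * t (.F j) * t (.Kinv i)) (qpow q (-g.ip i j) • t (.F j))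
  | E_F (i) : UqRel g q t
      ((qpow q (g.d i) - qpow q (-g.d i)) • (t (.E i) * t (.F i) - t (.F i) * t (.E i)))
      (t (.K i) - t (.Kinv i))
  | E_F_ne (i j) (h : i ≠ j) : UqRel g q t (t (.E i) * t (.F j) - t (.F j) * t (.E i)) 0
  | serre_E (i j) (h : i ≠ j) :
      UqRel g q t (qSerre q (g.ip i j) (g.ip i i) (t (.E i)) (t (.E j))) 0
  | serre_F (i j) (h : i ≠ j) :
      UqRel g q t (qSerre q (g.ip i j) (g.ip i i) (t (.F i)) (t (.F j))) 0

/-- The quantum group `U_q(𝔤)`. -/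
def Uq (g : OrthosymplecticType) (q : ℂˣ) : Type :=
  RingQuot (UqRel g q (FreeAlgebra.ι ℂ))

noncomputable instance (g : OrthosymplecticType) (q : ℂˣ) : Ring (Uq g q) :=
  inferInstanceAs (Ring (RingQuot _))

noncomputable instance (g : OrthosymplecticType) (q : ℂˣ) : Algebra ℂ (Uq g q) :=
  inferInstanceAs (Algebra ℂ (RingQuot _))

/-- The `q`-Serre relations for the generators `f_i` of `U_q(𝔤_-)`. -/
inductive UqNegRel (g : OrthosymplecticType) (q : ℂˣ) {A : Type*} [Ring A] [Algebra ℂ A]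
    (t : Fin g.rank → A) : A → A → Prop
  | serre (i j) (h : i ≠ j) : UqNegRel g q t (qSerre q (g.ip i j) (g.ip i i) (t i) (t j)) 0

/-- The algebra `U_q(𝔤_-)`. -/
def UqNeg (g : OrthosymplecticType) (q : ℂˣ) : Type :=
  RingQuot (UqNegRel g q (FreeAlgebra.ι ℂ))

noncomputable instance (g : OrthosymplecticType) (q : ℂˣ) : Ring (UqNeg g q) :=
  inferInstanceAs (Ring (RingQuot _))

noncomputable instance (g : OrthosymplecticType) (q : ℂˣ) : Algebra ℂ (UqNeg g q) :=
  inferInstanceAs (Algebra ℂ (RingQuot _))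

theorem qpow_zero (q : ℂˣ) : qpow q 0 = 1 := by simp [qpow]

theorem qpow_add (q : ℂˣ) (a b : ℤ) : qpow q (a + b) = qpow q a * qpow q b := by
  simp [qpow, zpow_add]

theorem qpow_ne_zero (q : ℂˣ) (a : ℤ) : qpow q a ≠ 0 := Units.ne_zero _

theorem qpow_neg (q : ℂˣ) (a : ℤ) : qpow q (-a) = (qpow q a)⁻¹ := by
  simp [qpow]

theorem map_qSerre {A B : Type*} [Ring A] [Algebra ℂ A] [Ring B] [Algebra ℂ B] (φ : A →ₐ[ℂ] B)
    (q : ℂˣ) (b c : ℤ) (X x : A) : φ (qSerre q b c X x) = qSerre q b c (φ X) (φ x) := by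
  unfold qSerre
  split_ifs <;> simp

theorem UqRel.map {g : OrthosymplecticType} {q : ℂˣ} {A B : Type*} [Ring A] [Algebra ℂ A]
    [Ring B] [Algebra ℂ B] (φ : A →ₐ[ℂ] B) {t : UqGen g → A} {x y : A} (h : UqRel g q t x y) :
    UqRel g q (fun s => φ (t s)) (φ x) (φ y) := by
  cases h with
  | K_mul_Kinv i => simpa using UqRel.K_mul_Kinv (t := fun s => φ (t s)) i
  | Kinv_mul_K i => simpa using UqRel.Kinv_mul_K (t := fun s => φ (t s)) i
  | K_comm i j => simpa using UqRel.K_comm (t := fun s => φ (t s)) i j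
  | K_E i j => simpa using UqRel.K_E (t := fun s => φ (t s)) i j
  | K_F i j => simpa using UqRel.K_F (t := fun s => φ (t s)) i j
  | E_F i => simpa using UqRel.E_F (t := fun s => φ (t s)) i
  | E_F_ne i j h => simpa using UqRel.E_F_ne (t := fun s => φ (t s)) i j h
  | serre_E i j h => simpa [map_qSerre] using UqRel.serre_E (t := fun s => φ (t s)) i j h
  | serre_F i j h => simpa [map_qSerre] using UqRel.serre_F (t := fun s => φ (t s)) i j h

namespace Uq

/-- The generators of `U_q(𝔤)`. -/
noncomputable def gen (g : OrthosymplecticType) (q : ℂˣ) (s : UqGen g) : Uq g q :=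
  RingQuot.mkAlgHom ℂ (UqRel g q (FreeAlgebra.ι ℂ)) (FreeAlgebra.ι ℂ s)

/-- The algebra homomorphism from `U_q(𝔤)` with given values on the generators, which must
satisfy the defining relations. -/
noncomputable def lift {g : OrthosymplecticType} {q : ℂˣ} {A : Type*} [Ring A] [Algebra ℂ A]
    (t : UqGen g → A) (ht : ∀ x y, UqRel g q t x y → x = y) : Uq g q →ₐ[ℂ] A :=
  RingQuot.liftAlgHom ℂ ⟨FreeAlgebra.lift ℂ t, fun x y h => ht _ _ <| by
    simpa using h.map (FreeAlgebra.lift ℂ t)⟩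

theorem lift_gen {g : OrthosymplecticType} {q : ℂˣ} {A : Type*} [Ring A] [Algebra ℂ A]
    (t : UqGen g → A) (ht : ∀ x y, UqRel g q t x y → x = y) (s : UqGen g) :
    lift t ht (gen g q s) = t s := by
  unfold lift gen
  exact (RingQuot.liftAlgHom_mkAlgHom_apply ℂ _ _ _).trans (by simp)

theorem rel {g : OrthosymplecticType} {q : ℂˣ} {x y : Uq g q}
    (h : UqRel g q (gen g q) x y) : x = y := by
  let π : FreeAlgebra ℂ (UqGen g) →ₐ[ℂ] Uq g q :=
    RingQuot.mkAlgHom ℂ (UqRel g q (FreeAlgebra.ι ℂ))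
  have hπ : ∀ {a b : FreeAlgebra ℂ (UqGen g)}, UqRel g q (FreeAlgebra.ι ℂ) a b → π a = π b :=
    fun h => RingQuot.mkAlgHom_rel ℂ h
  have hg : ∀ s, gen g q s = π (FreeAlgebra.ι ℂ s) := fun _ => rfl
  cases h with
  | K_mul_Kinv i => simpa [hg] using hπ (UqRel.K_mul_Kinv i)
  | Kinv_mul_K i => simpa [hg] using hπ (UqRel.Kinv_mul_K i)
  | K_comm i j => simpa [hg] using hπ (UqRel.K_comm i j)
  | K_E i j => simpa [hg] using hπ (UqRel.K_E i j)
  | K_F i j => simpa [hg] using hπ (UqRel.K_F i j)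
  | E_F i => simpa [hg] using hπ (UqRel.E_F i)
  | E_F_ne i j h => simpa [hg] using hπ (UqRel.E_F_ne i j h)
  | serre_E i j h => simpa [hg, map_qSerre] using hπ (UqRel.serre_E i j h)
  | serre_F i j h => simpa [hg, map_qSerre] using hπ (UqRel.serre_F i j h)

end Uq

namespace UqNeg

/-- The Chevalley generator `f_i` of `U_q(𝔤_-)`. -/
noncomputable def f (g : OrthosymplecticType) (q : ℂˣ) (i : Fin g.rank) : UqNeg g q :=
  RingQuot.mkAlgHom ℂ (UqNegRel g q (FreeAlgebra.ι ℂ)) (FreeAlgebra.ι ℂ i)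

/-- The natural homomorphism (an inclusion) from `U_q(𝔤_-)` to `U_q(𝔤)`, `f_i ↦ f_i`. -/
noncomputable def toUq (g : OrthosymplecticType) (q : ℂˣ) : UqNeg g q →ₐ[ℂ] Uq g q :=
  RingQuot.liftAlgHom ℂ ⟨FreeAlgebra.lift ℂ fun i => Uq.gen g q (.F i), by
    rintro _ _ ⟨i, j, h⟩
    simpa [map_qSerre] using Uq.rel (UqRel.serre_F i j h)⟩

theorem toUq_f (g : OrthosymplecticType) (q : ℂˣ) (i : Fin g.rank) :
    toUq g q (f g q i) = Uq.gen g q (.F i) := by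
  unfold toUq f
  exact (RingQuot.liftAlgHom_mkAlgHom_apply ℂ _ _ _).trans (by simp)

/-- The Chevalley monomial `f_{i_1} ⋯ f_{i_k}` of a word `i_1 … i_k`. -/
noncomputable def monomial (g : OrthosymplecticType) (q : ℂˣ) (l : List (Fin g.rank)) :
    UqNeg g q :=
  (l.map (f g q)).prod

/-- The set `Ψ_β` of the Chevalley monomials of weight `β`, i.e. of the products
`f_{i_1} ⋯ f_{i_k}` with `α_{i_1} + ⋯ + α_{i_k} = β`. -/
def chevalleyMonomials (g : OrthosymplecticType) (q : ℂˣ) (β : g.Weight) : Set (UqNeg g q) :=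
  {ψ | ∃ l : List (Fin g.rank), (l.map g.α).sum = β ∧ ψ = monomial g q l}

end UqNeg

/-! ## The comultiplication -/

theorem qserre_two {A : Type*} [Ring A] [Algebra ℂ A] (s : ℂ) (hs : s ≠ 0) (X x Y y : A)
    (h1 : X * Y = (s^2) • (Y * X)) (h2 : X * y = s⁻¹ • (y * X)) (h3 : x * Y = s⁻¹ • (Y * x))
    (hX : X * X * x - (s + s⁻¹) • (X * x * X) + x * X * X = 0)
    (hY : Y * Y * y - (s + s⁻¹) • (Y * y * Y) + y * Y * Y = 0) :
    (X+Y) * (X+Y) * (x+y) - (s + s⁻¹) • ((X+Y) * (x+y) * (X+Y)) + (x+y) * (X+Y) * (X+Y) = 0 := by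
  have h1' : ∀ z, X * (Y * z) = (s^2) • (Y * (X * z)) := fun z => by rw [← mul_assoc, h1, smul_mul_assoc, mul_assoc]
  have h2' : ∀ z, X * (y * z) = s⁻¹ • (y * (X * z)) := fun z => by rw [← mul_assoc, h2, smul_mul_assoc, mul_assoc]
  have h3' : ∀ z, x * (Y * z) = s⁻¹ • (Y * (x * z)) := fun z => by rw [← mul_assoc, h3, smul_mul_assoc, mul_assoc]
  have e : (X+Y) * (X+Y) * (x+y) - (s + s⁻¹) • ((X+Y) * (x+y) * (X+Y)) + (x+y) * (X+Y) * (X+Y)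
    = (X * X * x - (s + s⁻¹) • (X * x * X) + x * X * X) + (Y * Y * y - (s + s⁻¹) • (Y * y * Y) + y * Y * Y) := by
    simp only [add_mul, mul_add, mul_assoc, h1, h2, h3, h1', h2', h3', smul_mul_assoc, mul_smul_comm, smul_smul, smul_add]
    match_scalars <;> field_simp <;> ring
  rw [e, hX, hY, add_zero]

theorem qserre_three {A : Type*} [Ring A] [Algebra ℂ A] (s : ℂ) (hs : s ≠ 0) (X x Y y : A)
    (h1 : X * Y = s⁻¹ • (Y * X)) (h2 : X * y = s • (y * X)) (h3 : x * Y = s • (Y * x))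
    (hX : X * X * X * x - (s + 1 + s⁻¹) • (X * X * x * X) + (s + 1 + s⁻¹) • (X * x * X * X) - x * X * X * X = 0)
    (hY : Y * Y * Y * y - (s + 1 + s⁻¹) • (Y * Y * y * Y) + (s + 1 + s⁻¹) • (Y * y * Y * Y) - y * Y * Y * Y = 0) :
    (X+Y) * (X+Y) * (X+Y) * (x+y) - (s + 1 + s⁻¹) • ((X+Y) * (X+Y) * (x+y) * (X+Y))
      + (s + 1 + s⁻¹) • ((X+Y) * (x+y) * (X+Y) * (X+Y)) - (x+y) * (X+Y) * (X+Y) * (X+Y) = 0 := by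
  have h1' : ∀ z, X * (Y * z) = s⁻¹ • (Y * (X * z)) := fun z => by rw [← mul_assoc, h1, smul_mul_assoc, mul_assoc]
  have h2' : ∀ z, X * (y * z) = s • (y * (X * z)) := fun z => by rw [← mul_assoc, h2, smul_mul_assoc, mul_assoc]
  have h3' : ∀ z, x * (Y * z) = s • (Y * (x * z)) := fun z => by rw [← mul_assoc, h3, smul_mul_assoc, mul_assoc]
  have e : (X+Y) * (X+Y) * (X+Y) * (x+y) - (s + 1 + s⁻¹) • ((X+Y) * (X+Y) * (x+y) * (X+Y))
      + (s + 1 + s⁻¹) • ((X+Y) * (x+y) * (X+Y) * (X+Y)) - (x+y) * (X+Y) * (X+Y) * (X+Y)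
    = (X * X * X * x - (s + 1 + s⁻¹) • (X * X * x * X) + (s + 1 + s⁻¹) • (X * x * X * X) - x * X * X * X) + (Y * Y * Y * y - (s + 1 + s⁻¹) • (Y * Y * y * Y) + (s + 1 + s⁻¹) • (Y * y * Y * Y) - y * Y * Y * Y) := by
    simp only [add_mul, mul_add, mul_assoc, h1, h2, h3, h1', h2', h3', smul_mul_assoc, mul_smul_comm, smul_smul, smul_add]
    match_scalars <;> field_simp <;> ring
  rw [e, hX, hY, add_zero]

/-- If `X, x` and `Y, y` satisfy the `q`-Serre relation and `q`-commute with each other, then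
`X + Y, x + y` satisfy it as well. -/
theorem qSerre_add {A : Type*} [Ring A] [Algebra ℂ A] (q : ℂˣ) (b c : ℤ) (X x Y y : A)
    (h1 : X * Y = qpow q c • (Y * X)) (h2 : X * y = qpow q b • (y * X))
    (h3 : x * Y = qpow q b • (Y * x))
    (hX : qSerre q b c X x = 0) (hY : qSerre q b c Y y = 0) :
    qSerre q b c (X + Y) (x + y) = 0 := by
  unfold qSerre at *
  split_ifs at * with hb hb2 hb3
  · subst hb
    simp only [qpow_zero, one_smul] at h2 h3
    rw [sub_eq_zero] at hX hY
    rw [sub_eq_zero, add_mul, mul_add, mul_add, add_mul, mul_add, mul_add, hX, hY, h2, h3]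
    abel
  · have hc : c = (-b) + (-b) := by omega
    have e : qpow q b = (qpow q (-b))⁻¹ := by rw [qpow_neg, inv_inv]
    rw [hc, qpow_add, ← sq] at h1
    rw [add_comm (qpow q b), e] at hX hY ⊢
    rw [e] at h2 h3
    exact qserre_two _ (qpow_ne_zero _ _) X x Y y h1 h2 h3 hX hY
  · have hc : c = -b := by omega
    rw [hc, qpow_neg] at h1
    rw [qpow_neg] at hX hY ⊢
    exact qserre_three _ (qpow_ne_zero _ _) X x Y y h1 h2 h3 hX hY
  · rfl

namespace Uq

variable {g : OrthosymplecticType} {q : ℂˣ}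

theorem Kinv_mul_K (i : Fin g.rank) : gen g q (.Kinv i) * gen g q (.K i) = 1 :=
  rel (.Kinv_mul_K i)

theorem K_mul_Kinv (i : Fin g.rank) : gen g q (.K i) * gen g q (.Kinv i) = 1 :=
  rel (.K_mul_Kinv i)

theorem K_mul_E (i j : Fin g.rank) :
    gen g q (.K i) * gen g q (.E j) = qpow q (g.ip i j) • (gen g q (.E j) * gen g q (.K i)) := by
  have h := congrArg (· * gen g q (.K i)) (rel (g := g) (q := q) (.K_E i j))
  simpa [mul_assoc, Kinv_mul_K] using h

theorem K_mul_F (i j : Fin g.rank) :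
    gen g q (.K i) * gen g q (.F j) = qpow q (-g.ip i j) • (gen g q (.F j) * gen g q (.K i)) := by
  have h := congrArg (· * gen g q (.K i)) (rel (g := g) (q := q) (.K_F i j))
  simpa [mul_assoc, Kinv_mul_K] using h

theorem Kinv_mul_E (i j : Fin g.rank) :
    gen g q (.Kinv i) * gen g q (.E j)
      = qpow q (-g.ip i j) • (gen g q (.E j) * gen g q (.Kinv i)) := by
  have h := congrArg (fun z => gen g q (.Kinv i) * z * gen g q (.Kinv i)) (K_mul_E (q := q) i j)
  simp only [← mul_assoc, Kinv_mul_K, one_mul, mul_smul_comm, smul_mul_assoc] at h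
  rw [mul_assoc _ (gen g q (.K i)), K_mul_Kinv, mul_one] at h
  rw [h, smul_smul, ← qpow_add, neg_add_cancel, qpow_zero, one_smul]

theorem Kinv_mul_F (i j : Fin g.rank) :
    gen g q (.Kinv i) * gen g q (.F j)
      = qpow q (g.ip i j) • (gen g q (.F j) * gen g q (.Kinv i)) := by
  have h := congrArg (fun z => gen g q (.Kinv i) * z * gen g q (.Kinv i)) (K_mul_F (q := q) i j)
  simp only [← mul_assoc, Kinv_mul_K, one_mul, mul_smul_comm, smul_mul_assoc] at h
  rw [mul_assoc _ (gen g q (.K i)), K_mul_Kinv, mul_one] at h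
  rw [h, smul_smul, ← qpow_add, add_neg_cancel, qpow_zero, one_smul]

theorem K_comm (i j : Fin g.rank) :
    gen g q (.K i) * gen g q (.K j) = gen g q (.K j) * gen g q (.K i) :=
  rel (.K_comm i j)

theorem K_Kinv_comm (i j : Fin g.rank) :
    gen g q (.K i) * gen g q (.Kinv j) = gen g q (.Kinv j) * gen g q (.K i) := by
  have h := congrArg (fun z => gen g q (.Kinv j) * z * gen g q (.Kinv j)) (K_comm (q := q) i j)
  simp only [← mul_assoc, Kinv_mul_K, one_mul] at h
  rw [mul_assoc _ (gen g q (.K j)), K_mul_Kinv, mul_one] at h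
  exact h.symm

theorem Kinv_comm (i j : Fin g.rank) :
    gen g q (.Kinv i) * gen g q (.Kinv j) = gen g q (.Kinv j) * gen g q (.Kinv i) := by
  have h := congrArg (fun z => gen g q (.Kinv i) * z * gen g q (.Kinv i))
    (K_Kinv_comm (q := q) i j)
  simp only [← mul_assoc, Kinv_mul_K, one_mul] at h
  rw [mul_assoc _ (gen g q (.K i)), K_mul_Kinv, mul_one] at h
  exact h.symm

theorem E_F (i : Fin g.rank) :
    (qpow q (g.d i) - qpow q (-g.d i)) •
      (gen g q (.E i) * gen g q (.F i) - gen g q (.F i) * gen g q (.E i))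
      = gen g q (.K i) - gen g q (.Kinv i) := rel (.E_F i)

theorem E_F_ne {i j : Fin g.rank} (h : i ≠ j) :
    gen g q (.E i) * gen g q (.F j) = gen g q (.F j) * gen g q (.E i) :=
  sub_eq_zero.mp (rel (.E_F_ne i j h))

end Uq

theorem OrthosymplecticType.ip_comm (g : OrthosymplecticType) (i j : Fin g.rank) :
    g.ip i j = g.ip j i := dotProduct_comm _ _

theorem qSerre_tmul_left {A B : Type*} [Ring A] [Algebra ℂ A] [Ring B] [Algebra ℂ B] (q : ℂˣ)
    (b c : ℤ) (X x : A) (Z z : B) (hz : z * Z = Z * z) (h : qSerre q b c X x = 0) :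
    qSerre q b c (X ⊗ₜ[ℂ] Z) (x ⊗ₜ[ℂ] z) = 0 := by
  unfold qSerre at *
  split_ifs at * <;> first
    | rfl
    | (try simp only [mul_assoc] at h
       simp only [Algebra.TensorProduct.tmul_mul_tmul, mul_assoc, hz,
         ← TensorProduct.sub_tmul, ← TensorProduct.add_tmul, TensorProduct.smul_tmul']
       rw [h, TensorProduct.zero_tmul])

theorem qSerre_tmul_right {A B : Type*} [Ring A] [Algebra ℂ A] [Ring B] [Algebra ℂ B] (q : ℂˣ)
    (b c : ℤ) (X x : A) (Z z : B) (hz : z * Z = Z * z) (h : qSerre q b c X x = 0) :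
    qSerre q b c (Z ⊗ₜ[ℂ] X) (z ⊗ₜ[ℂ] x) = 0 := by
  have := qSerre_tmul_left q b c X x Z z hz h
  have := congrArg (Algebra.TensorProduct.comm ℂ A B).toAlgHom this
  rw [map_qSerre, map_zero] at this
  simpa using this

namespace Uq

/-- The values of the comultiplication on the generators. -/
noncomputable def comulGen (g : OrthosymplecticType) (q : ℂˣ) :
    UqGen g → Uq g q ⊗[ℂ] Uq g q
  | .E i => gen g q (.E i) ⊗ₜ 1 + gen g q (.K i) ⊗ₜ gen g q (.E i)
  | .F i => gen g q (.F i) ⊗ₜ gen g q (.Kinv i) + 1 ⊗ₜ gen g q (.F i)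
  | .K i => gen g q (.K i) ⊗ₜ gen g q (.K i)
  | .Kinv i => gen g q (.Kinv i) ⊗ₜ gen g q (.Kinv i)

theorem comulGen_rel (g : OrthosymplecticType) (q : ℂˣ) (x y : Uq g q ⊗[ℂ] Uq g q)
    (h : UqRel g q (comulGen g q) x y) : x = y := by
  cases h with
  | K_mul_Kinv i =>
    simp [comulGen, K_mul_Kinv, Algebra.TensorProduct.one_def]
  | Kinv_mul_K i =>
    simp [comulGen, Kinv_mul_K, Algebra.TensorProduct.one_def]
  | K_comm i j => simp [comulGen, K_comm i j]
  | K_E i j =>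
    have h : gen g q (.K i) * gen g q (.K j) * gen g q (.Kinv i) = gen g q (.K j) := by
      rw [K_comm, mul_assoc, K_mul_Kinv, mul_one]
    simp [comulGen, mul_add, add_mul, K_mul_Kinv, rel (.K_E i j), h, TensorProduct.smul_tmul']
  | K_F i j =>
    have h : gen g q (.K i) * gen g q (.Kinv j) * gen g q (.Kinv i) = gen g q (.Kinv j) := by
      rw [K_Kinv_comm, mul_assoc, K_mul_Kinv, mul_one]
    simp [comulGen, mul_add, add_mul, K_mul_Kinv, rel (.K_F i j), h, TensorProduct.smul_tmul']
  | E_F i =>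
    have h1 : (qpow q (g.d i) - qpow q (-g.d i)) • (comulGen g q (.E i) * comulGen g q (.F i)
        - comulGen g q (.F i) * comulGen g q (.E i))
        = ((qpow q (g.d i) - qpow q (-g.d i)) • (gen g q (.E i) * gen g q (.F i)
            - gen g q (.F i) * gen g q (.E i))) ⊗ₜ[ℂ] gen g q (.Kinv i)
          + gen g q (.K i) ⊗ₜ[ℂ] ((qpow q (g.d i) - qpow q (-g.d i)) •
            (gen g q (.E i) * gen g q (.F i) - gen g q (.F i) * gen g q (.E i))) := by
      simp only [comulGen, mul_add, add_mul, Algebra.TensorProduct.tmul_mul_tmul, mul_one, one_mul,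
        K_mul_F, Kinv_mul_E, TensorProduct.tmul_smul, ← TensorProduct.smul_tmul',
        TensorProduct.sub_tmul, TensorProduct.tmul_sub, ← smul_add]
      congr 1
      abel
    rw [h1, E_F]
    simp only [comulGen, TensorProduct.sub_tmul, TensorProduct.tmul_sub]
    abel
  | E_F_ne i j h =>
    simp only [comulGen, mul_add, add_mul, Algebra.TensorProduct.tmul_mul_tmul, mul_one, one_mul,
      K_mul_F, Kinv_mul_E, TensorProduct.tmul_smul, ← TensorProduct.smul_tmul', E_F_ne h,
      g.ip_comm j i]
    abel
  | serre_E i j h =>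
    rw [comulGen, comulGen, add_comm (gen g q (.E i) ⊗ₜ[ℂ] 1), add_comm (gen g q (.E j) ⊗ₜ[ℂ] 1)]
    refine qSerre_add q _ _ _ _ _ _ ?_ ?_ ?_ ?_ ?_
    · simp [K_mul_E, TensorProduct.smul_tmul']
    · simp [K_mul_E, TensorProduct.smul_tmul']
    · simp [K_mul_E, TensorProduct.smul_tmul', g.ip_comm j i]
    · exact qSerre_tmul_right q _ _ _ _ _ _ (K_comm _ _) (rel (.serre_E i j h))
    · exact qSerre_tmul_left q _ _ _ _ _ _ rfl (rel (.serre_E i j h))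
  | serre_F i j h =>
    refine qSerre_add q _ _ _ _ _ _ ?_ ?_ ?_ ?_ ?_
    · simp [Kinv_mul_F]
    · simp [Kinv_mul_F]
    · simp [Kinv_mul_F, g.ip_comm j i]
    · exact qSerre_tmul_left q _ _ _ _ _ _ (Kinv_comm _ _) (rel (.serre_F i j h))
    · exact qSerre_tmul_right q _ _ _ _ _ _ rfl (rel (.serre_F i j h))

/-- The comultiplication `Δ` of `U_q(𝔤)`. -/
noncomputable def comul (g : OrthosymplecticType) (q : ℂˣ) :
    Uq g q →ₐ[ℂ] Uq g q ⊗[ℂ] Uq g q :=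
  lift (comulGen g q) (comulGen_rel g q)

end Uq

/-! ## The natural representation -/

namespace OrthosymplecticType

def ind (a m : ℕ) : ℤ := if a = m then 1 else 0

theorem rawB (n i l r : ℕ) (hi : i < n) (hl : l < 2*n+1) (hr : r < 2*n+1) :
  (∀ a < n, ind a l - ind a (2*n+1-1-l) - (ind a r - ind a (2*n+1-1-r)) = ind a i - ind a (i+1)) ↔
   (r = l + 1 ∧ (l = i ∨ l + i + 1 = 2*n)) := by
  constructor
  · intro h
    have h1 := h i hi
    have h2 := h (i+1)
    have h3 := h l
    have h4 := h r
    have h5 := h (2*n - l)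
    have h6 := h (2*n - r)
    simp only [ind] at *
    clear h
    rcases lt_trichotomy l n with H | H | H <;> rcases lt_trichotomy r n with H' | H' | H' <;>  grind (splits := 40)
  · intro h a ha
    simp only [ind]
    split_ifs <;> omega

theorem rawC1 (n i l r : ℕ) (hi : i + 1 < n) (hl : l < 2*n) (hr : r < 2*n) :
  (∀ a < n, ind a l - ind a (2*n-1-l) - (ind a r - ind a (2*n-1-r)) = ind a i - ind a (i+1)) ↔
   (r = l + 1 ∧ (l = i ∨ l + i + 2 = 2*n)) := by
  constructor
  · intro h
    have h1 := h i (by omega)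
    have h2 := h (i+1) hi
    have h3 := h l
    have h4 := h r
    have h5 := h (2*n - 1 - l)
    have h6 := h (2*n - 1 - r)
    simp only [ind] at *
    clear h
    rcases lt_or_ge l n with H | H <;> rcases lt_or_ge r n with H' | H' <;>  grind (splits := 40)
  · intro h a ha
    simp only [ind]
    split_ifs <;> omega

theorem rawC2 (n i l r : ℕ) (hi : i + 1 = n) (hl : l < 2*n) (hr : r < 2*n) :
  (∀ a < n, ind a l - ind a (2*n-1-l) - (ind a r - ind a (2*n-1-r)) = 2 * ind a i) ↔
   (r = l + 1 ∧ (l = i)) := by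
  constructor
  · intro h
    have h1 := h i (by omega)
    have h3 := h l
    have h4 := h r
    have h5 := h (2*n - 1 - l)
    have h6 := h (2*n - 1 - r)
    simp only [ind] at *
    clear h
    rcases lt_or_ge l n with H | H <;> rcases lt_or_ge r n with H' | H' <;>  grind (splits := 40)
  · intro h a ha
    simp only [ind]
    split_ifs <;> omega

theorem rawD2 (n i l r : ℕ) (hn : 3 ≤ n) (hi : i + 1 = n) (hl : l < 2*n) (hr : r < 2*n) :
  (∀ a < n, ind a l - ind a (2*n-1-l) - (ind a r - ind a (2*n-1-r)) = ind a (i-1) + ind a i) ↔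
   (r = l + 2 ∧ (l + 1 = i ∨ l = i)) := by
  constructor
  · intro h
    have h1 := h i (by omega)
    have h2 := h (i-1) (by omega)
    have h3 := h l
    have h4 := h r
    have h5 := h (2*n - 1 - l)
    have h6 := h (2*n - 1 - r)
    simp only [ind] at *
    clear h
    rcases lt_or_ge l n with H | H <;> rcases lt_or_ge r n with H' | H' <;>  grind (splits := 40)
  · intro h a ha
    simp only [ind]
    split_ifs <;> omega
/-- The arrow of `e_i` in the representation diagram goes from `w_{s + len}` to `w_s` for the
two (or less) values `s = src i`, `s = N - 1 - src i - len i`. -/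
def src (g : OrthosymplecticType) (i : Fin g.rank) : ℤ :=
  match g.series with
  | .B => i
  | .C => i
  | .D => if (i : ℕ) + 1 = g.rank then i - 1 else i

def len (g : OrthosymplecticType) (i : Fin g.rank) : ℤ :=
  match g.series with
  | .B => 1
  | .C => 1
  | .D => if (i : ℕ) + 1 = g.rank then 2 else 1

theorem mem_P_α (g : OrthosymplecticType) (i : Fin g.rank) (l r : Fin g.natDim) :
    g.ε l - g.ε r = g.α i ↔ (r : ℤ) = l + g.len i ∧
      ((l : ℤ) = g.src i ∨ (l : ℤ) = g.natDim - 1 - g.src i - g.len i) := by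
  obtain ⟨s, n, hn⟩ := g
  obtain ⟨i, hi⟩ := i
  obtain ⟨l, hl⟩ := l
  obtain ⟨r, hr⟩ := r
  change i < n at hi
  have key : ∀ F G : Fin n → ℤ, F = G ↔ ∀ a (h : a < n), F ⟨a, h⟩ = G ⟨a, h⟩ := fun F G =>
    funext_iff.trans Fin.forall_iff
  refine (key _ _).trans ?_
  cases s
  · change l < 2 * n + 1 at hl
    change r < 2 * n + 1 at hr
    have e := rawB n i l r hi hl hr
    have e2 : (∀ a (h : a < n), (α ⟨.B, n, hn⟩ ⟨i, hi⟩) ⟨a, h⟩ = ind a i - ind a (i + 1)) := by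
      intro a h
      by_cases h' : i + 1 = n
      · simp [α, h', unitWeight, ind, h.ne]
      · simp [α, h', unitWeight, ind]
    simp only [e2]
    refine e.trans ?_
    simp only [len, src, natDim]
    omega
  · change l < 2 * n at hl
    change r < 2 * n at hr
    by_cases h' : i + 1 = n
    · have e := rawC2 n i l r h' hl hr
      have e2 : (∀ a (h : a < n), (α ⟨.C, n, hn⟩ ⟨i, hi⟩) ⟨a, h⟩ = 2 * ind a i) := by
        intro a h
        simp only [α, h', unitWeight, ind, if_true, Pi.add_apply, two_mul]
      simp only [e2]
      refine e.trans ?_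
      simp only [len, src, natDim]
      omega
    · have e := rawC1 n i l r (by omega) hl hr
      have e2 : (∀ a (h : a < n), (α ⟨.C, n, hn⟩ ⟨i, hi⟩) ⟨a, h⟩ = ind a i - ind a (i + 1)) := by
        intro a h
        simp [α, h', unitWeight, ind]
      simp only [e2]
      refine e.trans ?_
      simp only [len, src, natDim]
      omega
  · change l < 2 * n at hl
    change r < 2 * n at hr
    change 3 ≤ n at hn
    by_cases h' : i + 1 = n
    · have e := rawD2 n i l r hn h' hl hr
      have e2 : (∀ a (h : a < n), (α ⟨.D, n, hn⟩ ⟨i, hi⟩) ⟨a, h⟩ = ind a (i - 1) + ind a i) := by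
        intro a h
        simp [α, h', unitWeight, ind]
      simp only [e2]
      refine e.trans ?_
      simp only [len, src, natDim, h', if_true]
      omega
    · have e := rawC1 n i l r (by omega) hl hr
      have e2 : (∀ a (h : a < n), (α ⟨.D, n, hn⟩ ⟨i, hi⟩) ⟨a, h⟩ = ind a i - ind a (i + 1)) := by
        intro a h
        simp [α, h', unitWeight, ind]
      simp only [e2]
      refine e.trans ?_
      simp only [len, src, natDim, h', if_false]
      omega

theorem unitWeight_dotProduct (g : OrthosymplecticType) (m m' : ℕ) :
    g.unitWeight m ⬝ᵥ g.unitWeight m' = if m = m' ∧ m < g.rank then 1 else 0 := by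
  by_cases hm : m < g.rank
  · have : g.unitWeight m = Pi.single ⟨m, hm⟩ 1 := by
      funext a
      simp [unitWeight, Pi.single_apply, Fin.ext_iff]
    rw [this, single_dotProduct]
    simp [unitWeight, hm]
  · have : g.unitWeight m = 0 := by
      funext a
      have := a.2
      simp only [unitWeight, Pi.zero_apply, ite_eq_right_iff]
      omega
    simp [this, hm]

theorem ip_self (g : OrthosymplecticType) (i : Fin g.rank) :
    g.ip i i = match g.series with
      | .B => if (i : ℕ) + 1 = g.rank then 1 else 2
      | .C => if (i : ℕ) + 1 = g.rank then 4 else 2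
      | .D => 2 := by
  have hi := i.2
  have hn := g.minRank_le
  rcases hs : g.series <;> simp only [hs, OrthosymplecticSeries.minRank] at hn ⊢ <;>
    by_cases h' : (i : ℕ) + 1 = g.rank <;>
    simp only [ip, α, h', hs, unitWeight_dotProduct, true_and, if_true, if_false, add_dotProduct,
      dotProduct_add, sub_dotProduct, dotProduct_sub] <;> split_ifs <;> omega

theorem d_eq (g : OrthosymplecticType) (i : Fin g.rank) :
    g.d i = match g.series with
      | .B => 1
      | .C => if (i : ℕ) + 1 = g.rank then 2 else 1
      | .D => 1 := by
  rw [d, ip_self]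
  cases g.series <;> simp only <;> split_ifs <;> omega

/-- The pairing of `α_i` with `ε_k`. -/
theorem α_dotProduct_ε (g : OrthosymplecticType) (i : Fin g.rank) (k : Fin g.natDim) :
    g.α i ⬝ᵥ g.ε k = g.d i *
      ((if (k : ℤ) = g.src i ∨ (k : ℤ) = g.natDim - 1 - g.src i - g.len i then 1 else 0)
        - (if (k : ℤ) - g.len i = g.src i ∨
            (k : ℤ) - g.len i = g.natDim - 1 - g.src i - g.len i then 1 else 0)) := by
  rw [d_eq]
  have hi := i.2
  have hk := k.2
  have hn := g.minRank_le
  have hN : g.natDim = match g.series with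
    | .B => 2 * g.rank + 1
    | .C => 2 * g.rank
    | .D => 2 * g.rank := rfl
  simp only [ε]
  generalize (k : ℕ) = m at *
  generalize g.natDim = N at *
  rcases hs : g.series <;> simp only [hs, OrthosymplecticSeries.minRank] at hn hN ⊢ <;>
    by_cases h' : (i : ℕ) + 1 = g.rank <;>
    simp only [α, h', hs, src, len, unitWeight_dotProduct, if_true, if_false, add_dotProduct,
      sub_dotProduct, dotProduct_sub] <;> split_ifs <;> omega

theorem ip_eq_zero_cases (g : OrthosymplecticType) (i j : Fin g.rank)
    (h : g.ip i j = 0) : match g.series with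
      | .B => (i : ℕ) + 1 ≠ j ∧ (j : ℕ) + 1 ≠ i
      | .C => (i : ℕ) + 1 ≠ j ∧ (j : ℕ) + 1 ≠ i
      | .D => ((i : ℕ) + 1 ≠ j ∨ (j : ℕ) + 1 = g.rank) ∧
          ((j : ℕ) + 1 ≠ i ∨ (i : ℕ) + 1 = g.rank) ∧
          ((i : ℕ) + 2 ≠ j ∨ (j : ℕ) + 1 ≠ g.rank) ∧
          ((j : ℕ) + 2 ≠ i ∨ (i : ℕ) + 1 ≠ g.rank) := by
  have hi := i.2
  have hj := j.2
  have hn := g.minRank_le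
  rcases hs : g.series <;> simp only [hs, OrthosymplecticSeries.minRank] at hn ⊢ <;>
    by_cases h' : (i : ℕ) + 1 = g.rank <;> by_cases h'' : (j : ℕ) + 1 = g.rank <;>
    simp only [ip, α, h', h'', hs, unitWeight_dotProduct, if_true, if_false, add_dotProduct,
      dotProduct_add, sub_dotProduct, dotProduct_sub] at h <;> split_ifs at h <;> omega

end OrthosymplecticType

/-- A vector of `ℂ^N` extended by zero to a function on the integers. -/
def hat {N : ℕ} (v : Fin N → ℂ) (r : ℤ) : ℂ :=
  if h : 0 ≤ r ∧ r < N then v ⟨r.toNat, by omega⟩ else 0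

theorem hat_natCast {N : ℕ} (v : Fin N → ℂ) (k : Fin N) : hat v (k : ℕ) = v k := by
  have := k.2
  simp [hat]

theorem hat_eq_zero {N : ℕ} (v : Fin N → ℂ) (r : ℤ) (h : ¬ (0 ≤ r ∧ r < N)) : hat v r = 0 :=
  dif_neg h

theorem hat_inj {N : ℕ} {u v : Fin N → ℂ} (h : ∀ r : ℤ, 0 ≤ r → r < N → hat u r = hat v r) :
    u = v := by
  funext k
  have := k.2
  rw [← hat_natCast u, ← hat_natCast v]
  exact h _ (by omega) (by omega)

theorem hat_add {N : ℕ} (u v : Fin N → ℂ) (r : ℤ) : hat (u + v) r = hat u r + hat v r := by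
  unfold hat; split_ifs <;> simp

theorem hat_sub {N : ℕ} (u v : Fin N → ℂ) (r : ℤ) : hat (u - v) r = hat u r - hat v r := by
  unfold hat; split_ifs <;> simp

theorem hat_smul {N : ℕ} (c : ℂ) (v : Fin N → ℂ) (r : ℤ) : hat (c • v) r = c * hat v r := by
  unfold hat; split_ifs <;> simp

theorem hat_zero {N : ℕ} (r : ℤ) : hat (0 : Fin N → ℂ) r = 0 := by
  unfold hat; split_ifs <;> simp

open OrthosymplecticType in
/-- The matrices of the generators in the natural representation: `e_i` and `f_i` act by
`∑_{(l, r) ∈ P(α_i)} e_{lr}` and `∑_{(l, r) ∈ P(α_i)} e_{rl}` (a sum of matrix units), and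
`q^{±h_i} w_k = q^{±(α_i, ε_k)} w_k`. -/
noncomputable def natGen (g : OrthosymplecticType) (q : ℂˣ) :
    UqGen g → Matrix (Fin g.natDim) (Fin g.natDim) ℂ
  | .E i => Matrix.of fun l r => open Classical in if (l, r) ∈ g.P (g.α i) then 1 else 0
  | .F i => Matrix.of fun r l => open Classical in if (l, r) ∈ g.P (g.α i) then 1 else 0
  | .K i => Matrix.diagonal fun k => qpow q (g.α i ⬝ᵥ g.ε k)
  | .Kinv i => Matrix.diagonal fun k => qpow q (-(g.α i ⬝ᵥ g.ε k))

theorem mem_P_root (g : OrthosymplecticType) (i : Fin g.rank) (l r : Fin g.natDim) :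
    (l, r) ∈ g.P (g.α i) ↔ (r : ℤ) = l + g.len i ∧
      ((l : ℤ) = g.src i ∨ (l : ℤ) = g.natDim - 1 - g.src i - g.len i) :=
  g.mem_P_α i l r

theorem src_bounds (g : OrthosymplecticType) (i : Fin g.rank) :
    0 ≤ g.src i ∧ 0 < g.len i ∧ g.src i + g.len i < g.natDim := by
  obtain ⟨s, n, hn⟩ := g
  obtain ⟨i, hi⟩ := i
  change i < n at hi
  cases s <;> simp only [OrthosymplecticType.src, OrthosymplecticType.len,
    OrthosymplecticType.natDim]
  · omega
  · omega
  · change 3 ≤ n at hn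
    split_ifs <;> omega

theorem hat_E (g : OrthosymplecticType) (q : ℂˣ) (i : Fin g.rank) (v : Fin g.natDim → ℂ) (r : ℤ) :
    hat (natGen g q (.E i) *ᵥ v) r =
      if r = g.src i ∨ r = g.natDim - 1 - g.src i - g.len i then hat v (r + g.len i) else 0 := by
  obtain ⟨h1, h2, h3⟩ := src_bounds g i
  by_cases hr : 0 ≤ r ∧ r < g.natDim
  · obtain ⟨k, rfl⟩ := Int.eq_ofNat_of_zero_le hr.1
    have hk : k < g.natDim := by omega
    rw [show ((k : ℕ) : ℤ) = (((⟨k, hk⟩ : Fin g.natDim) : ℕ) : ℤ) from rfl, hat_natCast]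
    simp only [natGen, Matrix.mulVec, dotProduct, Matrix.of_apply, mem_P_root]
    split_ifs with h
    · have hk' : (k : ℤ) + g.len i < g.natDim := by omega
      have e : (k : ℤ) + g.len i = (((⟨(k + g.len i).toNat, by omega⟩ : Fin g.natDim) : ℕ) : ℤ) := by
        simp only; omega
      rw [e, hat_natCast, Finset.sum_eq_single ⟨(k + g.len i).toNat, by omega⟩]
      · rw [if_pos ⟨rfl, h⟩, one_mul]
      · intro b _ hb
        rw [if_neg, zero_mul]
        rintro ⟨hb', -⟩
        exact hb (Fin.ext (by simp only; omega))
      · simp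
    · simp [h]
  · rw [hat_eq_zero _ _ hr, if_neg (by omega)]

theorem hat_F (g : OrthosymplecticType) (q : ℂˣ) (i : Fin g.rank) (v : Fin g.natDim → ℂ) (r : ℤ) :
    hat (natGen g q (.F i) *ᵥ v) r =
      if r - g.len i = g.src i ∨ r - g.len i = g.natDim - 1 - g.src i - g.len i
        then hat v (r - g.len i) else 0 := by
  obtain ⟨h1, h2, h3⟩ := src_bounds g i
  by_cases hr : 0 ≤ r ∧ r < g.natDim
  · obtain ⟨k, rfl⟩ := Int.eq_ofNat_of_zero_le hr.1
    have hk : k < g.natDim := by omega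
    rw [show ((k : ℕ) : ℤ) = (((⟨k, hk⟩ : Fin g.natDim) : ℕ) : ℤ) from rfl, hat_natCast]
    simp only [natGen, Matrix.mulVec, dotProduct, Matrix.of_apply, mem_P_root]
    split_ifs with h
    · have e : (k : ℤ) - g.len i = (((⟨(k - g.len i).toNat, by omega⟩ : Fin g.natDim) : ℕ) : ℤ) := by
        simp only; omega
      rw [e, hat_natCast, Finset.sum_eq_single ⟨(k - g.len i).toNat, by omega⟩]
      · rw [if_pos ⟨by omega, by omega⟩, one_mul]
      · intro b _ hb
        rw [if_neg, zero_mul]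
        rintro ⟨hb', -⟩
        exact hb (Fin.ext (by simp only; omega))
      · simp
    · refine Finset.sum_eq_zero fun b _ => ?_
      rw [if_neg, zero_mul]
      omega
  · rw [hat_eq_zero _ _ hr, if_neg (by omega)]

theorem ext_hat {N : ℕ} {A B : Matrix (Fin N) (Fin N) ℂ}
    (h : ∀ (v : Fin N → ℂ) (r : ℤ), 0 ≤ r → r < N → hat (A *ᵥ v) r = hat (B *ᵥ v) r) : A = B :=
  Matrix.mulVec_injective (funext fun v => hat_inj (h v))

theorem natGen_F_mul (g : OrthosymplecticType) (q : ℂˣ) (i j : Fin g.rank) (hij : i ≠ j)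
    (h : g.ip i j = 0) :
    natGen g q (.F i) * natGen g q (.F j) = natGen g q (.F j) * natGen g q (.F i) := by
  refine ext_hat fun v r h0 hN => ?_
  have hc := g.ip_eq_zero_cases i j h
  rw [Ne, Fin.ext_iff] at hij
  have hi := i.2
  have hj := j.2
  have hn := g.minRank_le
  have hNat : g.natDim = match g.series with
    | .B => 2 * g.rank + 1
    | .C => 2 * g.rank
    | .D => 2 * g.rank := rfl
  simp only [← Matrix.mulVec_mulVec, hat_F]
  rcases hs : g.series <;> simp only [hs, OrthosymplecticSeries.minRank] at hn hNat hc <;>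
    simp only [OrthosymplecticType.src, OrthosymplecticType.len, hs]
  · split_ifs <;> first | rfl | omega
  · split_ifs <;> first | rfl | omega
  · split_ifs <;> first | rfl | omega | (congr 1; omega)

theorem natGen_F_sq (g : OrthosymplecticType) (q : ℂˣ) (i : Fin g.rank)
    (h : g.ip i i ≠ 1) : natGen g q (.F i) * natGen g q (.F i) = 0 := by
  refine ext_hat fun v r h0 hN => ?_
  have hi := i.2
  have hn := g.minRank_le
  have hNat : g.natDim = match g.series with
    | .B => 2 * g.rank + 1
    | .C => 2 * g.rank
    | .D => 2 * g.rank := rfl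
  rw [g.ip_self] at h
  simp only [← Matrix.mulVec_mulVec, hat_F, Matrix.zero_mulVec, hat_zero]
  rcases hs : g.series <;> simp only [hs, OrthosymplecticSeries.minRank] at hn hNat h <;>
    simp only [OrthosymplecticType.src, OrthosymplecticType.len, hs]
  · have h' : (i : ℕ) + 1 ≠ g.rank := by
      intro h'
      simp [h'] at h
    split_ifs <;> first | rfl | omega
  · split_ifs <;> first | rfl | omega
  · split_ifs <;> first | rfl | omega

theorem natGen_F_cube (g : OrthosymplecticType) (q : ℂˣ) (i : Fin g.rank)
    (h : g.ip i i = 1) :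
    natGen g q (.F i) * natGen g q (.F i) * natGen g q (.F i) = 0 := by
  refine ext_hat fun v r h0 hN => ?_
  have hi := i.2
  have hNat : g.natDim = match g.series with
    | .B => 2 * g.rank + 1
    | .C => 2 * g.rank
    | .D => 2 * g.rank := rfl
  rw [g.ip_self] at h
  simp only [← Matrix.mulVec_mulVec, hat_F, Matrix.zero_mulVec, hat_zero]
  rcases hs : g.series <;> simp only [hs] at hNat h <;>
    simp only [OrthosymplecticType.src, OrthosymplecticType.len, hs]
  · have h' : (i : ℕ) + 1 = g.rank := by
      by_contra h'
      simp [h'] at h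
    split_ifs <;> first | rfl | omega
  · split_ifs at h <;> omega
  · omega

theorem natGen_F_FFF (g : OrthosymplecticType) (q : ℂˣ) (i j : Fin g.rank) (hij : i ≠ j)
    (h : g.ip i i = 1 ∨ 2 * g.ip i j = -g.ip i i) :
    natGen g q (.F i) * natGen g q (.F j) * natGen g q (.F i) = 0 := by
  refine ext_hat fun v r h0 hN => ?_
  rw [Ne, Fin.ext_iff] at hij
  have hi := i.2
  have hj := j.2
  have hn := g.minRank_le
  have hNat : g.natDim = match g.series with
    | .B => 2 * g.rank + 1
    | .C => 2 * g.rank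
    | .D => 2 * g.rank := rfl
  rw [g.ip_self] at h
  simp only [← Matrix.mulVec_mulVec, hat_F, Matrix.zero_mulVec, hat_zero]
  rcases hs : g.series <;> simp only [hs, OrthosymplecticSeries.minRank] at hn hNat h
  · simp only [OrthosymplecticType.src, OrthosymplecticType.len, hs]
    split_ifs <;> first | rfl | omega
  · have h' : ¬ ((i : ℕ) + 2 = g.rank ∧ (j : ℕ) + 1 = g.rank) := by
      rintro ⟨h1, h2⟩
      have h3 : (i : ℕ) + 1 ≠ g.rank := by omega
      simp only [OrthosymplecticType.ip, OrthosymplecticType.α, h3, h2, hs,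
        OrthosymplecticType.unitWeight_dotProduct, if_true, if_false,
        dotProduct_add, sub_dotProduct] at h
      split_ifs at h <;> omega
    simp only [OrthosymplecticType.src, OrthosymplecticType.len, hs]
    split_ifs <;> first | rfl | omega
  · simp only [OrthosymplecticType.src, OrthosymplecticType.len, hs]
    split_ifs <;> first | rfl | omega

theorem natGen_serre_F (g : OrthosymplecticType) (q : ℂˣ) (i j : Fin g.rank) (hij : i ≠ j) :
    qSerre q (g.ip i j) (g.ip i i) (natGen g q (.F i)) (natGen g q (.F j)) = 0 := by
  unfold qSerre
  split_ifs with h1 h2 h3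
  · rw [natGen_F_mul g q i j hij h1, sub_self]
  · have e1 := natGen_F_sq g q i (by omega)
    have e2 := natGen_F_FFF g q i j hij (Or.inr h2)
    simp only [e1, e2, zero_mul, mul_assoc, mul_zero]
    simp
  · by_cases h4 : g.ip i i = 1
    · have e1 := natGen_F_cube g q i h4
      have e2 := natGen_F_FFF g q i j hij (Or.inl h4)
      rw [e1, mul_assoc (natGen g q (.F i) * natGen g q (.F i)), mul_assoc (natGen g q (.F i)),
        ← mul_assoc (natGen g q (.F i)) (natGen g q (.F j)), e2,
        mul_assoc (natGen g q (.F j) * natGen g q (.F i)), mul_assoc (natGen g q (.F j)),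
        ← mul_assoc (natGen g q (.F i)) (natGen g q (.F i)), e1]
      simp
    · have e1 := natGen_F_sq g q i h4
      simp [e1, mul_assoc]
  · rfl

theorem natGen_E_eq (g : OrthosymplecticType) (q : ℂˣ) (i : Fin g.rank) :
    natGen g q (.E i) = (natGen g q (.F i))ᵀ := rfl

theorem qSerre_transpose {N : ℕ} (q : ℂˣ) (b c : ℤ) (X x : Matrix (Fin N) (Fin N) ℂ)
    (h : qSerre q b c X x = 0) : qSerre q b c Xᵀ xᵀ = 0 := by
  unfold qSerre at *
  split_ifs at * with h1 h2 h3
  · rw [← Matrix.transpose_mul, ← Matrix.transpose_mul, ← Matrix.transpose_sub, ← neg_sub, h]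
    simp
  · have := congrArg Matrix.transpose h
    simp only [Matrix.transpose_add, Matrix.transpose_sub, Matrix.transpose_smul,
      Matrix.transpose_mul, Matrix.transpose_zero, mul_assoc] at this ⊢
    rw [← this]
    abel
  · have := congrArg Matrix.transpose h
    simp only [Matrix.transpose_add, Matrix.transpose_sub, Matrix.transpose_smul,
      Matrix.transpose_mul, Matrix.transpose_zero, mul_assoc] at this ⊢
    rw [← neg_eq_zero, ← this]
    abel
  · rfl

theorem natGen_E_F (g : OrthosymplecticType) (q : ℂˣ) (i : Fin g.rank) :
    (qpow q (g.d i) - qpow q (-g.d i)) •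
      (natGen g q (.E i) * natGen g q (.F i) - natGen g q (.F i) * natGen g q (.E i))
      = natGen g q (.K i) - natGen g q (.Kinv i) := by
  refine ext_hat fun v r h0 hN => ?_
  obtain ⟨k, rfl⟩ := Int.eq_ofNat_of_zero_le h0
  have hk : k < g.natDim := by omega
  obtain ⟨b1, b2, b3⟩ := src_bounds g i
  have hK : hat ((natGen g q (.K i) - natGen g q (.Kinv i)) *ᵥ v) ((k : ℕ) : ℤ)
      = (qpow q (g.α i ⬝ᵥ g.ε ⟨k, hk⟩) - qpow q (-(g.α i ⬝ᵥ g.ε ⟨k, hk⟩))) * v ⟨k, hk⟩ := by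
    rw [show ((k : ℕ) : ℤ) = (((⟨k, hk⟩ : Fin g.natDim) : ℕ) : ℤ) from rfl, hat_natCast]
    simp [natGen, Matrix.mulVec_diagonal, sub_mul]
  have hv : hat v ((k : ℕ) : ℤ) = v ⟨k, hk⟩ := by
    rw [show ((k : ℕ) : ℤ) = (((⟨k, hk⟩ : Fin g.natDim) : ℕ) : ℤ) from rfl, hat_natCast]
  rw [hK, g.α_dotProduct_ε, Matrix.smul_mulVec, Matrix.sub_mulVec, hat_smul, hat_sub]
  simp only [← Matrix.mulVec_mulVec, hat_F, hat_E, add_sub_cancel_right, sub_add_cancel, hv]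
  split_ifs <;> (simp [qpow_zero]; try ring)

theorem natGen_E_F_ne (g : OrthosymplecticType) (q : ℂˣ) (i j : Fin g.rank) (hij : i ≠ j) :
    natGen g q (.E i) * natGen g q (.F j) = natGen g q (.F j) * natGen g q (.E i) := by
  refine ext_hat fun v r h0 hN => ?_
  rw [Ne, Fin.ext_iff] at hij
  have hi := i.2
  have hj := j.2
  have hn := g.minRank_le
  have hNat : g.natDim = match g.series with
    | .B => 2 * g.rank + 1
    | .C => 2 * g.rank
    | .D => 2 * g.rank := rfl
  simp only [← Matrix.mulVec_mulVec, hat_F, hat_E]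
  rcases hs : g.series <;> simp only [hs, OrthosymplecticSeries.minRank] at hn hNat <;>
    simp only [OrthosymplecticType.src, OrthosymplecticType.len, hs]
  · split_ifs <;> first | rfl | omega
  · split_ifs <;> first | rfl | omega
  · split_ifs <;> first | rfl | omega | (congr 1; omega)

theorem natGen_rel (g : OrthosymplecticType) (q : ℂˣ)
    (x y : Matrix (Fin g.natDim) (Fin g.natDim) ℂ) (h : UqRel g q (natGen g q) x y) : x = y := by
  cases h with
  | K_mul_Kinv i => simp [natGen, Matrix.diagonal_mul_diagonal, ← qpow_add, qpow_zero]
  | Kinv_mul_K i => simp [natGen, Matrix.diagonal_mul_diagonal, ← qpow_add, qpow_zero]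
  | K_comm i j => simp [natGen, Matrix.diagonal_mul_diagonal, mul_comm]
  | K_E i j =>
    ext l r
    simp only [natGen, Matrix.mul_diagonal, Matrix.diagonal_mul, Matrix.of_apply,
      Matrix.smul_apply, OrthosymplecticType.ip, smul_eq_mul]
    split_ifs with h
    · have h' : g.ε l - g.ε r = g.α j := h
      rw [← h', dotProduct_sub, mul_one, mul_one, ← qpow_add, sub_eq_add_neg]
    · simp
  | K_F i j =>
    ext r l
    simp only [natGen, Matrix.mul_diagonal, Matrix.diagonal_mul, Matrix.of_apply,
      Matrix.smul_apply, OrthosymplecticType.ip, smul_eq_mul]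
    split_ifs with h
    · have h' : g.ε l - g.ε r = g.α j := h
      rw [← h', dotProduct_sub, mul_one, mul_one, ← qpow_add, neg_sub, sub_eq_add_neg]
    · simp
  | E_F i => exact natGen_E_F g q i
  | E_F_ne i j h => rw [natGen_E_F_ne g q i j h, sub_self]
  | serre_E i j h => exact qSerre_transpose _ _ _ _ _ (natGen_serre_F g q i j h)
  | serre_F i j h => exact natGen_serre_F g q i j h

/-- The natural representation `π` of `U_q(𝔤)` on `ℂ^N`. -/
noncomputable def natRep (g : OrthosymplecticType) (q : ℂˣ) :
    Uq g q →ₐ[ℂ] Module.End ℂ (Fin g.natDim → ℂ) :=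
  (Matrix.toLinAlgEquiv' (R := ℂ) (n := Fin g.natDim)).toAlgHom.comp
    (Uq.lift (natGen g q) (natGen_rel g q))

/-- The standard basis vectors `w_k` of `ℂ^N`. -/
noncomputable def natVec (g : OrthosymplecticType) (k : Fin g.natDim) : Fin g.natDim → ℂ :=
  Pi.single k 1

/-- `ψ` is the principal monomial `ψ^{ij}`: there is a Chevalley monomial `f_{i_1} ⋯ f_{i_k}`
which sends `w_i` to `w_j` up to an invertible scalar factor, and `ψ` is obtained from it by
reversing the order of the factors. -/
def IsPrincipalMonomial (g : OrthosymplecticType) (q : ℂˣ) (i j : Fin g.natDim)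
    (ψ : UqNeg g q) : Prop :=
  ∃ l : List (Fin g.rank),
    (∃ c : ℂ, c ≠ 0 ∧ natRep g q (UqNeg.toUq g q (UqNeg.monomial g q l)) (natVec g i) = c • natVec g j) ∧
    ψ = UqNeg.monomial g q l.reverse

/-! ## Verma modules and the standard filtration -/

/-- The left ideal of `U_q(𝔤)` generated by `e_i` and `q^{h_i} - q^{(λ, α_i)}`. A weight `λ` is
given by the character `q^{h_i} ↦ q^{(λ, α_i)}`, an arbitrary family of non-zero numbers. -/
noncomputable def vermaIdeal (g : OrthosymplecticType) (q : ℂˣ) (lam : Fin g.rank → ℂˣ) :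
    Submodule (Uq g q) (Uq g q) :=
  Submodule.span (Uq g q)
    (Set.range (fun i => Uq.gen g q (.E i)) ∪
      Set.range (fun i => Uq.gen g q (.K i) - algebraMap ℂ (Uq g q) (lam i)))

/-- The Verma module `M_λ`. -/
abbrev Verma (g : OrthosymplecticType) (q : ℂˣ) (lam : Fin g.rank → ℂˣ) : Type :=
  Uq g q ⧸ vermaIdeal g q lam

/-- The canonical generator `v_λ` of the Verma module. -/
noncomputable def vermaVec (g : OrthosymplecticType) (q : ℂˣ) (lam : Fin g.rank → ℂˣ) : Verma g q lam :=
  Submodule.Quotient.mk 1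

/-- The tensor product `ℂ^N ⊗ M_λ`. -/
def NatTensorVerma (g : OrthosymplecticType) (q : ℂˣ) (lam : Fin g.rank → ℂˣ) : Type :=
  (Fin g.natDim → ℂ) ⊗[ℂ] Verma g q lam

noncomputable instance (g : OrthosymplecticType) (q : ℂˣ) (lam : Fin g.rank → ℂˣ) :
    AddCommGroup (NatTensorVerma g q lam) :=
  inferInstanceAs (AddCommGroup ((Fin g.natDim → ℂ) ⊗[ℂ] Verma g q lam))

/-- The action of `U_q(𝔤)` on `ℂ^N ⊗ M_λ` through the comultiplication. -/
noncomputable def tensorRep (g : OrthosymplecticType) (q : ℂˣ) (lam : Fin g.rank → ℂˣ) :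
    Uq g q →ₐ[ℂ] Module.End ℂ ((Fin g.natDim → ℂ) ⊗[ℂ] Verma g q lam) :=
  ((Module.endTensorEndAlgHom (R := ℂ) (S := ℂ) (A := ℂ)).comp
    (Algebra.TensorProduct.map (natRep g q) (Algebra.lsmul ℂ ℂ (Verma g q lam)))).comp
    (Uq.comul g q)

noncomputable instance (g : OrthosymplecticType) (q : ℂˣ) (lam : Fin g.rank → ℂˣ) :
    Module (Uq g q) (NatTensorVerma g q lam) :=
  Module.compHom ((Fin g.natDim → ℂ) ⊗[ℂ] Verma g q lam) (tensorRep g q lam).toRingHom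

/-- The element `u ⊗ m` of `ℂ^N ⊗ M_λ`. -/
noncomputable def NatTensorVerma.tmul {g : OrthosymplecticType} {q : ℂˣ} {lam : Fin g.rank → ℂˣ}
    (u : Fin g.natDim → ℂ) (m : Verma g q lam) : NatTensorVerma g q lam :=
  u ⊗ₜ[ℂ] m

/-- The standard filtration of `ℂ^N ⊗ M_λ`: the `m`-th term is the `U_q(𝔤)`-submodule generated
by `w_k ⊗ v_λ` for the first `m` basis vectors `w_k`. -/
noncomputable def standardFiltration (g : OrthosymplecticType) (q : ℂˣ) (lam : Fin g.rank → ℂˣ)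
    (m : ℕ) : Submodule (Uq g q) (NatTensorVerma g q lam) :=
  Submodule.span (Uq g q)
    {x | ∃ k : Fin g.natDim, (k : ℕ) < m ∧ x = NatTensorVerma.tmul (natVec g k) (vermaVec g q lam)}

/-! Write `ψ = f_a ψ'`. Since `Δ(f_a) = f_a ⊗ q^{-h_a} + 1 ⊗ f_a`, the vector `w_i ⊗ f_a ψ' v_λ`
equals `f_a (w_i ⊗ ψ' v_λ) - (f_a w_i) ⊗ q^{-h_a} ψ' v_λ`. Here `q^{-h_a}` only rescales `ψ' v_λ`,
and `f_a w_i` is either `0` or a single basis vector `w_k` with `k = i + len a`. So, modulo scalars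
and the action of `U_q(𝔤)`, each letter of the word either is dropped while the index `i` stays put,
or pushes the index forward by its length (`tmul_monomial_cons_mem`).

The lengths are governed by a linear functional on weights: for `(i, j) ∈ P(β)`, every word of
weight `β` has total length `j - i` (`add_sum_len_eq`). Lengths are positive, so once a letter is
dropped the index can only end strictly before `j`, and the resulting term lies in the span of the
earlier generators (`tmul_monomial_mem_of_lt`).

The one remaining branch lets every letter act on the first factor, from left to right. If it
survives to the end, it carries `w_i` to `w_j`; the reversed word then sends `w_i` to `w_j`, which
is exactly what makes `ψ` principal. For a non-principal `ψ` this branch must therefore vanish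
(`tmul_monomial_mem_of_not_isPrincipalMonomial`). -/

namespace OrthosymplecticType

/-! ### Heights of weights and lengths of words -/

/-- The additive functional on the weights with value `N - 1 - 2 k` at `ε_k`. -/
def height (g : OrthosymplecticType) : g.Weight →+ ℤ where
  toFun x := (fun a : Fin g.rank => (g.natDim : ℤ) - 1 - 2 * (a : ℕ)) ⬝ᵥ x
  map_zero' := dotProduct_zero _
  map_add' := dotProduct_add _

theorem height_unitWeight (g : OrthosymplecticType) (m : ℕ) :
    g.height (g.unitWeight m) = if m < g.rank then (g.natDim : ℤ) - 1 - 2 * m else 0 := by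
  change (fun a : Fin g.rank => (g.natDim : ℤ) - 1 - 2 * (a : ℕ)) ⬝ᵥ g.unitWeight m = _
  split_ifs with hm
  · have : g.unitWeight m = Pi.single ⟨m, hm⟩ 1 := by
      funext a
      simp [unitWeight, Pi.single_apply, Fin.ext_iff]
    rw [this, dotProduct_single, mul_one]
  · have : g.unitWeight m = 0 := by
      funext a
      have := a.2
      simp only [unitWeight, Pi.zero_apply, ite_eq_right_iff]
      omega
    rw [this, dotProduct_zero]

/-- The expression `N - 1 - 2 k` changes sign under `k ↦ N - 1 - k`, as `ε_k` does, so one formula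
covers both halves of the basis; it gives `0` at the middle index of series `B`. -/
theorem height_ε (g : OrthosymplecticType) (k : Fin g.natDim) :
    g.height (g.ε k) = (g.natDim : ℤ) - 1 - 2 * (k : ℕ) := by
  have hk := k.2
  have hN : g.natDim = match g.series with
    | .B => 2 * g.rank + 1
    | .C => 2 * g.rank
    | .D => 2 * g.rank := rfl
  rw [ε, map_sub, height_unitWeight, height_unitWeight]
  rcases hs : g.series <;> simp only [hs] at hN <;> split_ifs <;> omega

/-- An arrow of `α_i` joins indices differing by `len i`, and the height drops by `2` per index. The
last root `ε_{n-1} + ε_n` of series `D` has height `3 + 1`, in accordance with its length `2`. -/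
theorem height_α (g : OrthosymplecticType) (i : Fin g.rank) :
    g.height (g.α i) = 2 * g.len i := by
  have hi := i.2
  have hn := g.minRank_le
  have hN : g.natDim = match g.series with
    | .B => 2 * g.rank + 1
    | .C => 2 * g.rank
    | .D => 2 * g.rank := rfl
  rcases hs : g.series <;> simp only [hs, OrthosymplecticSeries.minRank] at hn hN <;>
    by_cases h' : (i : ℕ) + 1 = g.rank <;>
    simp only [α, len, h', hs, if_true, if_false, map_add, map_sub, height_unitWeight] <;>
    split_ifs <;> omega

theorem height_sum_α (g : OrthosymplecticType) (l : List (Fin g.rank)) :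
    g.height (l.map g.α).sum = 2 * (l.map g.len).sum := by
  induction l with
  | nil => simp
  | cons a l ih => simp [ih, height_α, mul_add]

/-- If `(i, j) ∈ P(β)`, then the lengths of the simple steps in a word of weight `β` sum up to
`j - i`. -/
theorem add_sum_len_eq (g : OrthosymplecticType) {i j : Fin g.natDim} {l : List (Fin g.rank)}
    (h : (i, j) ∈ g.P (l.map g.α).sum) : ((i : ℕ) : ℤ) + (l.map g.len).sum = (j : ℕ) := by
  have h' := congrArg g.height (show g.ε i - g.ε j = (l.map g.α).sum from h)
  rw [map_sub, height_ε, height_ε, height_sum_α] at h'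
  omega

end OrthosymplecticType

/-! ### Chevalley generators on basis vectors, and monomials of words -/

/-- All arrows of a given simple root have the same length, so at most one of them starts at `w_i`;
its matrix coefficient is exactly `1`. -/
theorem natRep_F_natVec (g : OrthosymplecticType) (q : ℂˣ) (a : Fin g.rank) (i : Fin g.natDim) :
    natRep g q (Uq.gen g q (.F a)) (natVec g i) = 0 ∨
      ∃ k : Fin g.natDim, ((k : ℕ) : ℤ) = (i : ℕ) + g.len a ∧
        natRep g q (Uq.gen g q (.F a)) (natVec g i) = natVec g k := by
  have key : natRep g q (Uq.gen g q (.F a)) (natVec g i) = natGen g q (.F a) *ᵥ Pi.single i 1 := by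
    simp [natRep, natVec, Uq.lift_gen]
  rw [key]
  by_cases h : ∃ k, (i, k) ∈ g.P (g.α a)
  · obtain ⟨k, hk⟩ := h
    have hk' := (mem_P_root g a i k).1 hk
    refine Or.inr ⟨k, hk'.1, ?_⟩
    funext r
    simp only [Matrix.mulVec_single_one, Matrix.col_apply, natGen, Matrix.of_apply, natVec,
      Pi.single_apply]
    -- Both sides are indicators in `r`; their conditions agree because `(i, r) ∈ P(α_a)` forces `r
    -- = i + len a`.
    congr 1
    refine propext ⟨fun hr => ?_, fun hr => hr ▸ hk⟩
    have hr' := (mem_P_root g a i r).1 hr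
    exact Fin.ext (by omega)
  · refine Or.inl (funext fun r => ?_)
    simp only [Matrix.mulVec_single_one, Matrix.col_apply, natGen, Matrix.of_apply,
      Pi.zero_apply]
    exact if_neg fun hr => h ⟨r, hr⟩

namespace UqNeg

theorem monomial_cons (g : OrthosymplecticType) (q : ℂˣ) (a : Fin g.rank)
    (l : List (Fin g.rank)) : monomial g q (a :: l) = f g q a * monomial g q l := by
  simp [monomial]

theorem monomial_append (g : OrthosymplecticType) (q : ℂˣ) (l l' : List (Fin g.rank)) :
    monomial g q (l ++ l') = monomial g q l * monomial g q l' := by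
  simp [monomial]

end UqNeg

/-! ### Weight vectors of the Verma module -/

theorem Kinv_smul_vermaVec (g : OrthosymplecticType) (q : ℂˣ) (lam : Fin g.rank → ℂˣ)
    (a : Fin g.rank) : Uq.gen g q (.Kinv a) • vermaVec g q lam
      = ((lam a)⁻¹ : ℂ) • vermaVec g q lam := by
  have h : Uq.gen g q (.K a) • vermaVec g q lam = (lam a : ℂ) • vermaVec g q lam := by
    rw [← sub_eq_zero, ← algebraMap_smul (Uq g q) (lam a : ℂ), ← sub_smul]
    refine (Submodule.Quotient.mk_eq_zero _).2 ?_
    simp only [smul_eq_mul, mul_one]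
    exact Submodule.subset_span (Or.inr ⟨a, rfl⟩)
  have h' := congrArg (Uq.gen g q (.Kinv a) • ·) h
  simp only [← mul_smul, Uq.Kinv_mul_K, one_smul] at h'
  rw [smul_comm (Uq.gen g q (.Kinv a)) (lam a : ℂ)] at h'
  -- At this point `h'` reads `v_λ = λ_a • q^{-h_a} v_λ`. It expands `v_λ` on both sides; the
  -- scalars cancel on the right, and the left is folded back.
  rw [h', smul_smul, inv_mul_cancel₀ (Units.ne_zero _), one_smul, ← h']

/-- Monomials applied to `v_λ` are weight vectors: moving `q^{-h_a}` past each `f_b` costs a factor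
`q^{(α_a, α_b)}`. Only the existence of the scalar matters for membership in a submodule. -/
theorem exists_Kinv_smul_monomial (g : OrthosymplecticType) (q : ℂˣ) (lam : Fin g.rank → ℂˣ)
    (a : Fin g.rank) (l : List (Fin g.rank)) :
    ∃ c : ℂ, Uq.gen g q (.Kinv a) • UqNeg.toUq g q (UqNeg.monomial g q l) • vermaVec g q lam
      = c • UqNeg.toUq g q (UqNeg.monomial g q l) • vermaVec g q lam := by
  induction l with
  | nil => exact ⟨((lam a)⁻¹ : ℂ), by simpa [UqNeg.monomial] using Kinv_smul_vermaVec g q lam a⟩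
  | cons b l ih =>
    obtain ⟨c, hc⟩ := ih
    refine ⟨qpow q (g.ip a b) * c, ?_⟩
    rw [UqNeg.monomial_cons, map_mul, UqNeg.toUq_f, mul_smul, ← mul_smul (Uq.gen g q (.Kinv a)),
      Uq.Kinv_mul_F, smul_assoc, mul_smul, hc, smul_comm _ c, smul_smul]

/-! ### The tensor product as a module over the quantum group -/

namespace NatTensorVerma

variable {g : OrthosymplecticType} {q : ℂˣ} {lam : Fin g.rank → ℂˣ}

theorem F_smul_tmul (a : Fin g.rank) (u : Fin g.natDim → ℂ) (m : Verma g q lam) :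
    Uq.gen g q (.F a) • tmul u m
      = tmul (natRep g q (Uq.gen g q (.F a)) u) (Uq.gen g q (.Kinv a) • m)
        + tmul u (Uq.gen g q (.F a) • m) := by
  change tensorRep g q lam (Uq.gen g q (.F a)) (u ⊗ₜ[ℂ] m) = _ ⊗ₜ[ℂ] _ + _ ⊗ₜ[ℂ] _
  simp [tensorRep, Uq.comul, Uq.lift_gen, Uq.comulGen, Module.endTensorEndAlgHom_apply]
  rfl

/-- The terms of the filtration are submodules over `U_q(𝔤)`, so a complex scalar has to act through
`algebraMap` before it can be absorbed. -/
theorem tmul_smul (u : Fin g.natDim → ℂ) (c : ℂ) (m : Verma g q lam) :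
    tmul u (c • m) = algebraMap ℂ (Uq g q) c • tmul u m := by
  change u ⊗ₜ[ℂ] (c • m) = tensorRep g q lam (algebraMap ℂ (Uq g q) c) (u ⊗ₜ[ℂ] m)
  rw [AlgHom.commutes, Module.algebraMap_end_apply, TensorProduct.tmul_smul]

theorem zero_tmul (m : Verma g q lam) : tmul 0 m = 0 := TensorProduct.zero_tmul _ _

end NatTensorVerma

/-! ### Membership in the standard filtration -/

section Filtration

variable (g : OrthosymplecticType) (q : ℂˣ) (lam : Fin g.rank → ℂˣ)

/-- Moving a Chevalley generator from the second tensor factor to the first one. -/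
theorem tmul_monomial_cons_mem (V : Submodule (Uq g q) (NatTensorVerma g q lam)) (a : Fin g.rank)
    (l : List (Fin g.rank)) (i : Fin g.natDim)
    (h : NatTensorVerma.tmul (natVec g i)
      (UqNeg.toUq g q (UqNeg.monomial g q l) • vermaVec g q lam) ∈ V)
    (h' : ∀ k : Fin g.natDim, ((k : ℕ) : ℤ) = (i : ℕ) + g.len a →
      natRep g q (Uq.gen g q (.F a)) (natVec g i) = natVec g k →
      NatTensorVerma.tmul (natVec g k)
        (UqNeg.toUq g q (UqNeg.monomial g q l) • vermaVec g q lam) ∈ V) :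
    NatTensorVerma.tmul (natVec g i)
      (UqNeg.toUq g q (UqNeg.monomial g q (a :: l)) • vermaVec g q lam) ∈ V := by
  rw [UqNeg.monomial_cons, map_mul, UqNeg.toUq_f, mul_smul]
  have e := NatTensorVerma.F_smul_tmul (lam := lam) a (natVec g i)
    (UqNeg.toUq g q (UqNeg.monomial g q l) • vermaVec g q lam)
  -- The coproduct formula solved for its second term, `w_i ⊗ f_a ψ' v_λ`.
  rw [← sub_eq_iff_eq_add'.2 e]
  refine V.sub_mem (V.smul_mem _ h) ?_
  obtain ⟨c, hc⟩ := exists_Kinv_smul_monomial g q lam a l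
  rw [hc, NatTensorVerma.tmul_smul]
  refine V.smul_mem _ ?_
  obtain h0 | ⟨k, hk, hk'⟩ := natRep_F_natVec g q a i
  · rw [h0, NatTensorVerma.zero_tmul]
    exact V.zero_mem
  · rw [hk']
    exact h' k hk hk'

/-- The index plus the length of the remaining word bounds every index that can be reached. Pushing
with a letter preserves this sum and dropping a letter decreases it, so only generators with index
below `m` occur. -/
theorem tmul_monomial_mem_of_lt (m : ℕ) (l : List (Fin g.rank)) (i : Fin g.natDim)
    (h : ((i : ℕ) : ℤ) + (l.map g.len).sum < m) :
    NatTensorVerma.tmul (natVec g i)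
      (UqNeg.toUq g q (UqNeg.monomial g q l) • vermaVec g q lam) ∈
        standardFiltration g q lam m := by
  induction l generalizing i with
  | nil =>
    refine Submodule.subset_span ⟨i, by simpa using h, ?_⟩
    simp [UqNeg.monomial]
  | cons a l ih =>
    rw [List.map_cons, List.sum_cons] at h
    have ha := (src_bounds g a).2.1
    exact tmul_monomial_cons_mem g q lam _ a l i (ih i (by omega))
      fun k hk _ => ih k (by omega)

/-- To act on `w_i` by `f_a` first, the letter `a` is appended at the right end of the word taking
`w_k` to `w_j`; reversal moves it to the front. This matches the order in which letters are peeled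
off `ψ`. -/
theorem IsPrincipalMonomial.f_mul {g : OrthosymplecticType} {q : ℂˣ} {i k j : Fin g.natDim}
    {a : Fin g.rank} {ψ : UqNeg g q} (h : IsPrincipalMonomial g q k j ψ)
    (ha : natRep g q (Uq.gen g q (.F a)) (natVec g i) = natVec g k) :
    IsPrincipalMonomial g q i j (UqNeg.f g q a * ψ) := by
  obtain ⟨l, ⟨c, hc, hl⟩, rfl⟩ := h
  refine ⟨l ++ [a], ⟨c, hc, ?_⟩, ?_⟩
  · rw [UqNeg.monomial_append, map_mul, map_mul, Module.End.mul_apply]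
    simpa [UqNeg.monomial, UqNeg.toUq_f, ha] using hl
  · rw [List.reverse_append, List.reverse_singleton, List.singleton_append, UqNeg.monomial_cons]

theorem tmul_monomial_mem_of_not_isPrincipalMonomial (l : List (Fin g.rank))
    (i j : Fin g.natDim) (h : ((i : ℕ) : ℤ) + (l.map g.len).sum = (j : ℕ))
    (hne : ¬ IsPrincipalMonomial g q i j (UqNeg.monomial g q l)) :
    NatTensorVerma.tmul (natVec g i)
      (UqNeg.toUq g q (UqNeg.monomial g q l) • vermaVec g q lam) ∈
        standardFiltration g q lam (j : ℕ) := by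
  induction l generalizing i with
  | nil =>
    obtain rfl : i = j := Fin.ext (by simpa using h)
    -- For the empty word `i = j`, and `1` is the principal monomial, so this case contradicts
    -- `hne`.
    exact absurd ⟨[], ⟨1, one_ne_zero, by simp [UqNeg.monomial]⟩, rfl⟩ hne
  | cons a l ih =>
    rw [List.map_cons, List.sum_cons] at h
    have ha := (src_bounds g a).2.1
    -- If `a` is dropped, the inequality becomes strict because `len a > 0`. If `a` pushes `w_i` to
    -- `w_k`, the equality persists for `k`, and a principal remainder for `(k, j)` would make the
    -- whole monomial principal for `(i, j)`.
    refine tmul_monomial_cons_mem g q lam _ a l i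
      (tmul_monomial_mem_of_lt g q lam _ l i (by omega)) fun k hk hk' =>
        ih k (by omega) fun hp => hne ?_
    rw [UqNeg.monomial_cons]
    exact hp.f_mul hk'

end Filtration

/-- Let `ψ` be a Chevalley monomial of weight `β`, let `(i, j) ∈ P(β)`, and suppose that `ψ` is
not the principal monomial `ψ^{ij}`. Then `w_i ⊗ ψ v_λ` lies in the submodule of `ℂ^N ⊗ M_λ`
generated by `w_k ⊗ v_λ`, `k < j`. -/
theorem mainTheorem5 (g : OrthosymplecticType) (q : ℂˣ) (hq : ∀ m : ℕ, 0 < m → q ^ m ≠ 1)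
    (lam : Fin g.rank → ℂˣ) (β : g.Weight) (i j : Fin g.natDim) (hij : (i, j) ∈ g.P β)
    (ψ : UqNeg g q) (hψ : ψ ∈ UqNeg.chevalleyMonomials g q β)
    (hne : ¬ IsPrincipalMonomial g q i j ψ) :
    NatTensorVerma.tmul (natVec g i) (UqNeg.toUq g q ψ • vermaVec g q lam) ∈
      standardFiltration g q lam (j : ℕ) := by
  -- Any word representing `ψ` with weight `β` will do. With indices from `0`, the bound `k < j`
  -- describes the term called `V_{j-1}` when counting from `1`.
  obtain ⟨l, rfl, rfl⟩ := hψ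
  exact tmul_monomial_mem_of_not_isPrincipalMonomial g q lam l i j (g.add_sum_len_eq hij) hne
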